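/- \textbf{Farkas lemma for finitary binary oriented matroids.} \emph{Definitions.} Let $M$ be a finitary matroid (all circuits are finite) on a possibly infinite ground set $E$. It is \emph{binary} if there is a family $(v_e)_{e\in E}$ of vectors in a vector space over $\mathbb{F}_2$ such that a set $I\subseteq E$ is independent in $M$ if and only if $(v_e)_{e\in I}$ is linearly independent. A \emph{cocircuit} of $M$ is a circuit of the dual matroid, equivalently a minimal nonempty $D\subseteq E$ with $|D\cap C|\neq 1$ for every circuit $C$. A \emph{signed set} $X$ is a $\pm1$-valued function on a set $\underline{X}$; put $X^{+}=\{x\in\underline{X}: X(x)=1\}$ and $X^{-}=\{x\in\underline{X}: X(x)=-1\}$. It is \emph{positive} if it is constant $1$, and it is a signed set \emph{through} $e$ if $e\in\underline{X}$. A \emph{signature} of a set $\mathcal{F}$ of nonempty sets is a set of signed sets that consists of exactly two signings of each $F\in\mathcal{F}$, these two being opposite. An \emph{orientation} of $M$ is a signature $\mathcal{O}$ of the set of circuits of $M$ such that for all $C_0,C_1\in\mathcal{O}$ with $C_1\neq\pm C_0$ and every $f\in C_0^{+}\cap C_1^{-}$ there is a $C\in\mathcal{O}$ with $C^{-}\subseteq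 (C_0^{-}\cup C_1^{-})\setminus\{f\}$ and $C^{+}\subseteq (C_0^{+}\cup C_1^{+})\setminus\{f\}$. Then $\vec{M}=(E,\mathcal{O})$ is a \emph{finitary binary oriented matroid} if $M$ is finitary and binary. Its signed cocircuits $\mathcal{O}^{*}$ are the signings $D$ of cocircuits of $M$ that are orthogonal to all signed circuits: for every $C\in\mathcal{O}$ with $\underline{C}\cap\underline{D}\neq\emptyset$, the restriction of $C$ to $\underline{C}\cap\underline{D}$ is neither equal nor opposite to the restriction of $D$. A \emph{positive circuit} (\emph{positive cocircuit}) of $\vec{M}$ is a positive element of $\mathcal{O}$ (of $\mathcal{O}^{*}$). \emph{Statement.} Let $\vec{M}=(E,\mathcal{O})$ be a finitary binary oriented matroid. Then for every $e\in E$ there is either a positive circuit or a positive cocircuit of $\vec{M}$ through $e$, but not both. -/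

import Mathlib

universe u

/-- A signed set with elements in `α`: a `±1`-valued function on a subset of `α`, encoded as its
extension by `0` to all of `α`. Its domain is recovered as the support. -/
abbrev SignedSet (α : Type u) : Type u := α → SignType

namespace SignedSet

variable {α : Type u}

/-- The underlying set (domain) of a signed set. -/
def underlying (X : SignedSet α) : Set α := {e | X e ≠ 0}

/-- The elements of sign `1`. -/
def pos (X : SignedSet α) : Set α := {e | X e = 1}

/-- The elements of sign `-1`. -/
def neg (X : SignedSet α) : Set α := {e | X e = -1}

/-- A signed set is positive if it is constant `1` on its domain. -/
def IsPositive (X : SignedSet α) : Prop := ∀ e ∈ X.underlying, X e = 1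

/-- Orthogonality: if the domains of `C` and `D` meet, then the restrictions of `C` and `D` to the
intersection of the domains are neither equal nor opposite. -/
def Orthogonal (C D : SignedSet α) : Prop :=
  (C.underlying ∩ D.underlying).Nonempty →
    (¬ ∀ e ∈ C.underlying ∩ D.underlying, C e = D e) ∧
    (¬ ∀ e ∈ C.underlying ∩ D.underlying, C e = - D e)

/-- A signature of a family `F` of (nonempty) sets: a set of signings of members of `F` that
contains exactly two signings of each member of `F`, and these two are opposite. -/
def IsSignature (O : Set (SignedSet α)) (F : Set (Set α)) : Prop :=
  (∀ X ∈ O, X.underlying ∈ F) ∧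
  ∀ S ∈ F, ∃ X : SignedSet α, X.underlying = S ∧ {Y ∈ O | Y.underlying = S} = {X, -X}

end SignedSet

namespace Matroid

variable {α : Type u}

/-- A matroid is binary if it is represented by a family of vectors in a vector space over the
two-element field: a subset of the ground set is independent in the matroid exactly if the
corresponding subfamily is linearly independent. (Since the span of such a family has a basis
indexed by a subset of `α`, there is no loss in taking the vector space in the universe of `α`.) -/
def IsBinary (M : Matroid α) : Prop :=
  ∃ (V : Type u) (_ : AddCommGroup V) (_ : Module (ZMod 2) V) (v : α → V),
    ∀ I : Set α, I ⊆ M.E → (M.Indep I ↔ LinearIndepOn (ZMod 2) v I)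

/-- An orientation of a matroid: a signature of its circuits satisfying the oriented circuit
elimination axiom. -/
structure Orientation (M : Matroid α) where
  /-- The signed circuits. -/
  circuits : Set (SignedSet α)
  isSignature : SignedSet.IsSignature circuits {C | M.IsCircuit C}
  elimination : ∀ C₀ ∈ circuits, ∀ C₁ ∈ circuits, C₁ ≠ C₀ → C₁ ≠ -C₀ →
    ∀ e ∈ C₀.pos ∩ C₁.neg, ∃ C ∈ circuits,
      C.neg ⊆ (C₀.neg ∪ C₁.neg) \ {e} ∧ C.pos ⊆ (C₀.pos ∪ C₁.pos) \ {e}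

/-- The signed cocircuits of an oriented matroid: the signings of cocircuits that are orthogonal
to every signed circuit. By `Orientation.eq_cocircuits` this is the only set that can be a signature
of the cocircuits orthogonal to the signed circuits. -/
def Orientation.cocircuits {M : Matroid α} (O : M.Orientation) : Set (SignedSet α) :=
  {D | M.IsCocircuit D.underlying ∧ ∀ C ∈ O.circuits, C.Orthogonal D}

theorem IsCocircuit.exists_isCircuit_inter_eq_pair {M : Matroid α} {K : Set α}
    (hK : M.IsCocircuit K) {e f : α} (he : e ∈ K) (hf : f ∈ K) (hne : f ≠ e) :
    ∃ C, M.IsCircuit C ∧ C ∩ K = {e, f} := by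
  obtain ⟨B', hB', hsub⟩ := (hK.sdiff_singleton_indep hf).exists_isBase_superset
  have hfB' : f ∉ B' := fun h => hK.not_indep (hB'.indep.subset (fun x hx => by
    by_cases hxf : x = f
    · exact hxf ▸ h
    · exact hsub ⟨hx, hxf⟩))
  have heB' : e ∈ B' := hsub ⟨he, fun h => hne h.symm⟩
  have hB : M.IsBase (M.E \ B') := hB'.compl_isBase_of_dual
  have hKE : K ⊆ M.E := hK.subset_ground
  have hKeq : K = M.fundCocircuit f (M.E \ B') := by
    have hB'E : B' ⊆ M.E := hB'.subset_ground
    have h1 : M✶.E \ (M.E \ B') = B' := by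
      simp [Set.sdiff_sdiff_cancel_left hB'E]
    rw [Matroid.fundCocircuit, h1]
    refine IsCircuit.eq_fundCircuit_of_subset hK hB'.indep (fun x hx => ?_)
    by_cases hxf : x = f
    · exact Or.inl hxf
    · exact Or.inr (hsub ⟨hx, hxf⟩)
  have hmem : f ∈ M.fundCircuit e (M.E \ B') := by
    rw [← hB.mem_fundCocircuit_iff_mem_fundCircuit, ← hKeq]; exact he
  refine ⟨M.fundCircuit e (M.E \ B'), hB.fundCircuit_isCircuit (hKE he) (fun h => h.2 heB'), ?_⟩
  ext x
  constructor
  · rintro ⟨hx, hxK⟩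
    rcases M.fundCircuit_subset_insert e _ hx with h | h
    · exact Or.inl h
    · by_cases hxf : x = f
      · exact Or.inr hxf
      · exact absurd (hsub ⟨hxK, hxf⟩) h.2
  · rintro (rfl | h)
    · exact ⟨M.mem_fundCircuit _ _, he⟩
    · obtain rfl : x = f := h
      exact ⟨hmem, hf⟩

/-- A signature of the cocircuits that is orthogonal to the signed circuits equals
`Orientation.cocircuits`. -/
theorem Orientation.eq_cocircuits {M : Matroid α} (O : M.Orientation) {N : Set (SignedSet α)}
    (hN : SignedSet.IsSignature N {D | M.IsCocircuit D})
    (hON : ∀ C ∈ O.circuits, ∀ D ∈ N, C.Orthogonal D) : N = O.cocircuits := by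
  refine Set.Subset.antisymm (fun D hD => ⟨hN.1 D hD, fun C hC => hON C hC D hD⟩) ?_
  rintro D ⟨hDK, hDO⟩
  obtain ⟨X, hXD, hX⟩ := hN.2 _ hDK
  have hXN : X ∈ N := (hX.ge (Set.mem_insert X {-X})).1
  have hXN' : -X ∈ N := (hX.ge (Set.mem_insert_of_mem X rfl)).1
  obtain ⟨e, he⟩ := hDK.nonempty
  have key : ∀ f ∈ D.underlying, f ≠ e → D f * X e = X f * D e := by
    intro f hf hne
    obtain ⟨C, hC, hCK⟩ := hDK.exists_isCircuit_inter_eq_pair he hf hne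
    obtain ⟨Y, hYC, hY⟩ := O.isSignature.2 C hC
    have hYO : Y ∈ O.circuits := (hY.ge (Set.mem_insert Y {-Y})).1
    have h1 := hDO Y hYO
    have h2 := hON Y hYO X hXN
    rw [SignedSet.Orthogonal, hYC, hCK] at h1
    rw [SignedSet.Orthogonal, hXD, hYC, hCK] at h2
    have h1' := h1 ⟨e, Or.inl rfl⟩
    have h2' := h2 ⟨e, Or.inl rfl⟩
    simp only [Set.mem_insert_iff, Set.mem_singleton_iff, forall_eq_or_imp, forall_eq] at h1' h2'
    have hXe : X e ≠ 0 := by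
      have : e ∈ X.underlying := hXD ▸ he
      exact this
    have hXf : X f ≠ 0 := by
      have : f ∈ X.underlying := hXD ▸ hf
      exact this
    have hDe : D e ≠ 0 := he
    have hDf : D f ≠ 0 := hf
    have hYe : Y e ≠ 0 := by
      have : e ∈ Y.underlying := by
        rw [hYC]; exact (hCK.ge (Or.inl rfl)).1
      exact this
    have hYf : Y f ≠ 0 := by
      have : f ∈ Y.underlying := by
        rw [hYC]; exact (hCK.ge (Or.inr rfl)).1
      exact this
    have aux : ∀ a b p q : SignType, a ≠ 0 → b ≠ 0 → p ≠ 0 → q ≠ 0 →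
        ¬ (p = a ∧ q = b) ∧ ¬ (p = -a ∧ q = -b) → b = -(p * q) * a := by
      intro a b p q
      cases a <;> cases b <;> cases p <;> cases q <;> decide
    rw [aux _ _ _ _ hDe hDf hYe hYf h1', aux _ _ _ _ hXe hXf hYe hYf h2', mul_right_comm]
  have hXe : X e ≠ 0 := by
    have : e ∈ X.underlying := hXD ▸ he
    exact this
  have hzero : ∀ f, f ∉ D.underlying → D f = 0 ∧ X f = 0 := by
    intro f hf
    refine ⟨not_not.1 hf, ?_⟩
    rw [← hXD] at hf
    exact not_not.1 hf
  have hDe : D e ≠ 0 := he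
  have hcase : D e = X e ∨ D e = - X e := by
    generalize X e = a at *
    generalize D e = b at *
    clear * - hXe hDe
    revert a b
    decide
  have hD : D = X ∨ D = -X := by
    refine hcase.imp (fun h => ?_) (fun h => ?_)
    · funext f
      by_cases hf : f ∈ D.underlying
      · by_cases hfe : f = e
        · rw [hfe, h]
        · have := key f hf hfe
          rw [h] at this
          exact mul_right_cancel₀ hXe this
      · rw [(hzero f hf).1, (hzero f hf).2]
    · funext f
      rw [Pi.neg_apply]
      by_cases hf : f ∈ D.underlying
      · by_cases hfe : f = e
        · rw [hfe, h]
        · have := key f hf hfe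
          rw [h] at this
          refine mul_right_cancel₀ hXe (this.trans ?_)
          generalize X e = a
          generalize X f = b
          revert a b
          decide
      · rw [(hzero f hf).1, (hzero f hf).2]; rfl
  rcases hD with h | h
  · exact h ▸ hXN
  · exact h ▸ hXN'

end Matroid

/-! ### Symmetric differences of circuits in binary matroids -/

namespace Matroid

variable {α : Type u} {M : Matroid α}

/-! A positive circuit and a positive cocircuit sharing `e` would agree on their intersection,
against orthogonality. For existence, suppose no positive circuit passes through `e`. Zorn's lemma
gives a maximal set `Z` avoiding `e` and containing the negative part of no signed circuit positive
at `e`; chains have upper bounds because circuits are finite. The all-positive signing of the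
complement of `Z` is the desired cocircuit.

To prove this, signed circuits are added as integer vectors. Binarity makes that useful:
`exists_relation_lattice` puts all signed circuits in a lattice in which the support of every
nonzero vector contains a circuit. It rests on thetas, where signed circuits add up exactly
(`exists_eq_add_of_theta`), and on reduction modulo 2. By `exists_conformal_through`, each element
of the support of a lattice vector lies in a signed circuit compatible with its signs. So the
property defining `Z` passes to the lattice, and sums of circuits witnessing maximality give the
contradictions. -/

theorem IsBinary.exists_vectors (hM : M.IsBinary) :
    ∃ (V : Type u) (_ : AddCommGroup V) (_ : Module (ZMod 2) V) (v : α → V),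
      (∀ S : Finset α, M.IsCircuit S → ∑ a ∈ S, v a = 0) ∧
      ∀ S : Finset α, (S : Set α) ⊆ M.E → S.Nonempty → ∑ a ∈ S, v a = 0 →
        ∃ C ⊆ (S : Set α), M.IsCircuit C := by
  obtain ⟨V, _, _, v, hv⟩ := hM
  have hdep : ∀ S : Finset α, (S : Set α) ⊆ M.E → S.Nonempty → ∑ a ∈ S, v a = 0 →
      ¬ M.Indep S := by
    intro S hSE ⟨a, ha⟩ hS hI
    have := linearIndepOn_finset_iff.1 ((hv S hSE).1 hI) (fun _ => 1) (by simpa using hS) a ha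
    exact one_ne_zero this
  refine ⟨V, inferInstance, inferInstance, v, fun S hS => ?_, fun S hSE hne hS =>
    Dep.exists_isCircuit_subset ⟨hdep S hSE hne hS, hSE⟩⟩
  have hli : ¬ LinearIndepOn (ZMod 2) v (S : Set α) :=
    fun h => hS.not_indep ((hv _ hS.subset_ground).2 h)
  rw [linearIndepOn_finset_iff] at hli
  push Not at hli
  obtain ⟨c, hc, a, haS, hca⟩ := hli
  -- Nonzero coefficients over the two-element field are 1, so the support of a linear dependency is
  -- itself a zero-sum set. It is dependent, hence all of the circuit.
  set T : Finset α := S.filter (fun b => c b ≠ 0) with hT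
  have hTS : (T : Set α) ⊆ S := by
    rw [hT]; exact_mod_cast Finset.filter_subset _ _
  have hsum : ∑ b ∈ T, v b = 0 := by
    rw [← hc, hT, Finset.sum_filter]
    refine Finset.sum_congr rfl fun b _ => ?_
    have h01 : ∀ z : ZMod 2, z = 0 ∨ z = 1 := by decide
    rcases h01 (c b) with h | h <;> simp [h]
  have hTeq : (T : Set α) = S := hS.eq_of_not_indep_subset
    (hdep T (hTS.trans hS.subset_ground) ⟨a, by simp [hT, haS, hca]⟩ hsum) hTS
  rwa [Finset.coe_injective hTeq] at hsum

/-- In characteristic 2 the vectors on the symmetric difference sum to the total over both circuits,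
which is zero. -/
theorem IsBinary.exists_isCircuit_subset_symmDiff [M.Finitary] (hM : M.IsBinary) {C₁ C₂ : Set α}
    (h₁ : M.IsCircuit C₁) (h₂ : M.IsCircuit C₂) (hne : C₁ ≠ C₂) :
    ∃ C ⊆ symmDiff C₁ C₂, M.IsCircuit C := by
  classical
  obtain ⟨V, _, _, v, hv, hv'⟩ := hM.exists_vectors
  lift C₁ to Finset α using h₁.finite
  lift C₂ to Finset α using h₂.finite
  have h := hv' (symmDiff C₁ C₂) ?_ ?_ ?_
  · simpa using h
  · rw [Finset.coe_symmDiff]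
    exact Set.symmDiff_subset_union.trans
      (Set.union_subset h₁.subset_ground h₂.subset_ground)
  · rw [Finset.nonempty_iff_ne_empty, ← Finset.bot_eq_empty, Ne, symmDiff_eq_bot]
    exact fun h => hne (by rw [h])
  · have e₁ := Finset.sum_sdiff (f := v) (Finset.inter_subset_left (s₁ := C₁) (s₂ := C₂))
    have e₂ := Finset.sum_sdiff (f := v) (Finset.inter_subset_right (s₁ := C₁) (s₂ := C₂))
    rw [Finset.sdiff_inter_self_left, hv _ h₁] at e₁
    rw [Finset.sdiff_inter_self_right, hv _ h₂] at e₂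
    rw [symmDiff, Finset.sup_eq_union,
      Finset.sum_union (Finset.disjoint_of_subset_right Finset.sdiff_subset Finset.sdiff_disjoint),
      eq_neg_of_add_eq_zero_left e₁, eq_neg_of_add_eq_zero_left e₂, ← neg_add, ← two_smul (ZMod 2),
      show (2 : ZMod 2) = 0 from rfl, zero_smul, neg_zero]

/-- If `C'` is minimal modulo `C`, then the only circuits in the union of the two circuits are
`C`, `C'` and their symmetric difference. -/
theorem IsBinary.eq_symmDiff_of_minimal [M.Finitary] (hM : M.IsBinary) {C C' : Set α}
    (hC : M.IsCircuit C) (hC' : M.IsCircuit C') (hne : C' ≠ C)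
    (hmin : ∀ C'', M.IsCircuit C'' → C'' ≠ C → C'' ⊆ C ∪ C' → C' ⊆ C'' ∪ C)
    {K : Set α} (hK : M.IsCircuit K) (hKC : K ≠ C) (hKC' : K ≠ C') (hKsub : K ⊆ C ∪ C') :
    K = symmDiff C C' := by
  have h1 := hmin K hK hKC hKsub
  -- `K` and `C'` agree outside `C`, so `J` lies in `C` and equals it. Hence every element of `C`
  -- outside `C'` is in `K`.
  obtain ⟨J, hJ, hJc⟩ := hM.exists_isCircuit_subset_symmDiff hK hC' hKC'
  have hJC : J ⊆ C := by
    intro x hx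
    rcases hJ hx with ⟨h, h'⟩ | ⟨h, h'⟩
    · exact (hKsub h).resolve_right h'
    · exact (h1 h).resolve_left h'
  have hJeq : J = C := hC.eq_of_superset_isCircuit hJc hJC |>.symm
  have hsub : symmDiff C C' ⊆ K := by
    rintro x (⟨h, h'⟩ | ⟨h, h'⟩)
    · rw [← hJeq] at h
      exact (hJ h).elim (·.1) (fun h => absurd h.1 h')
    · exact (h1 h).resolve_right h'
  obtain ⟨L, hL, hLc⟩ := hM.exists_isCircuit_subset_symmDiff hC hC' hne.symm
  have := hK.eq_of_superset_isCircuit hLc (hL.trans hsub)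
  exact (this ▸ hL).antisymm hsub

end Matroid

/-! ### Signed circuits and theta configurations -/

namespace SignedSet
variable {α : Type u}

@[simp] theorem mem_underlying {X : SignedSet α} {a : α} : a ∈ X.underlying ↔ X a ≠ 0 := Iff.rfl

@[simp] theorem underlying_neg (X : SignedSet α) : (-X).underlying = X.underlying := by
  ext a; simp

end SignedSet

namespace Matroid.Orientation

variable {α : Type u} {M : Matroid α} (O : M.Orientation)

theorem isCircuit {C : SignedSet α} (hC : C ∈ O.circuits) : M.IsCircuit C.underlying :=
  O.isSignature.1 C hC

theorem eq_or_eq_neg {C D : SignedSet α} (hC : C ∈ O.circuits) (hD : D ∈ O.circuits)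
    (h : D.underlying = C.underlying) : D = C ∨ D = -C := by
  obtain ⟨X, -, hXO⟩ := O.isSignature.2 _ (O.isCircuit hC)
  have h1 : C = X ∨ C = -X := hXO.le ⟨hC, rfl⟩
  have h2 : D = X ∨ D = -X := hXO.le ⟨hD, h⟩
  rcases h1 with rfl | rfl <;> rcases h2 with rfl | rfl <;> simp

theorem neg_mem {C : SignedSet α} (hC : C ∈ O.circuits) : -C ∈ O.circuits := by
  obtain ⟨X, -, hXO⟩ := O.isSignature.2 _ (O.isCircuit hC)
  have h1 : C = X ∨ C = -X := hXO.le ⟨hC, rfl⟩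
  have hX : X ∈ O.circuits := (hXO.ge (Or.inl rfl)).1
  have hX' : -X ∈ O.circuits := (hXO.ge (Or.inr rfl)).1
  rcases h1 with rfl | rfl
  · exact hX'
  · simpa using hX

theorem exists_signing {K : Set α} (hK : M.IsCircuit K) : ∃ C ∈ O.circuits, C.underlying = K := by
  obtain ⟨X, hX, hXO⟩ := O.isSignature.2 _ hK
  exact ⟨X, (hXO.ge (Or.inl rfl)).1, hX⟩

theorem exists_signing_apply_eq {K : Set α} (hK : M.IsCircuit K) {a : α} (ha : a ∈ K)
    {s : SignType} (hs : s ≠ 0) : ∃ C ∈ O.circuits, C.underlying = K ∧ C a = s := by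
  obtain ⟨C, hC, rfl⟩ := O.exists_signing hK
  have h : C a = s ∨ (-C) a = s := by
    rw [SignedSet.mem_underlying] at ha
    rw [Pi.neg_apply]
    generalize C a = t at *
    revert s t; decide
  exact h.elim (fun h => ⟨C, hC, rfl, h⟩) (fun h => ⟨-C, O.neg_mem hC, by simp, h⟩)

/-- Circuit elimination for an element at which two signed circuits have opposite signs. -/
theorem exists_elimination {C D : SignedSet α} (hC : C ∈ O.circuits) (hD : D ∈ O.circuits)
    (hne : D.underlying ≠ C.underlying) {f : α} (hf : C f ≠ 0) (hfD : D f = -C f) :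
    ∃ X ∈ O.circuits, X f = 0 ∧ ∀ a, X a ≠ 0 → X a = C a ∨ X a = D a := by
  have key : ∀ C ∈ O.circuits, ∀ D ∈ O.circuits, D.underlying ≠ C.underlying → C f = 1 →
      D f = -1 → ∃ X ∈ O.circuits, X f = 0 ∧ ∀ a, X a ≠ 0 → X a = C a ∨ X a = D a := by
    intro C hC D hD hne h1 h2
    obtain ⟨X, hX, hn, hp⟩ := O.elimination C hC D hD (by rintro rfl; exact hne rfl)
      (by rintro rfl; simp at hne) f ⟨h1, h2⟩
    refine ⟨X, hX, ?_, fun a ha => ?_⟩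
    · rcases (X f).trichotomy with h | h | h
      · exact absurd rfl (hn h).2
      · exact h
      · exact absurd rfl (hp h).2
    · rcases (X a).trichotomy with h | h | h
      · exact (hn h).1.imp (fun h' => h.trans (Eq.symm h')) (fun h' => h.trans (Eq.symm h'))
      · exact absurd h ha
      · exact (hp h).1.imp (fun h' => h.trans (Eq.symm h')) (fun h' => h.trans (Eq.symm h'))
  rcases (C f).trichotomy with h | h | h
  · obtain ⟨X, hX, h0, h'⟩ := key D hD C hC hne.symm (by simp [hfD, h]) h
    exact ⟨X, hX, h0, fun a ha => (h' a ha).symm⟩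
  · exact absurd h hf
  · exact key C hC D hD hne h (by rw [hfD, h])

/-- In a theta configuration, two signed circuits that disagree at a common element disagree at all
common elements, and the third circuit is their sum. -/
theorem exists_eq_add_of_theta {C D : SignedSet α} (hC : C ∈ O.circuits) (hD : D ∈ O.circuits)
    (hne : D.underlying ≠ C.underlying)
    (htheta : ∀ K, M.IsCircuit K → K ≠ C.underlying → K ≠ D.underlying →
      K ⊆ C.underlying ∪ D.underlying → K = symmDiff C.underlying D.underlying)
    {f : α} (hf : C f ≠ 0) (hfD : D f = -C f) :
    ∃ X ∈ O.circuits, X.underlying = symmDiff C.underlying D.underlying ∧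
      ∀ a, (X a : ℤ) = C a + D a := by
  -- Stated for arbitrary `D` because it is also applied to `-D` below.
  have elim : ∀ D ∈ O.circuits, D.underlying ≠ C.underlying →
      (∀ K, M.IsCircuit K → K ≠ C.underlying → K ≠ D.underlying →
      K ⊆ C.underlying ∪ D.underlying → K = symmDiff C.underlying D.underlying) →
      ∀ g, C g ≠ 0 → D g = -C g → ∃ X ∈ O.circuits,
        X.underlying = symmDiff C.underlying D.underlying ∧ (∀ a, D a = 0 → X a = C a) ∧
        (∀ a, C a = 0 → X a = D a) := by
    intro D hD hne htheta g hg hgD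
    obtain ⟨X, hX, h0, h⟩ := O.exists_elimination hC hD hne hg hgD
    have hXu : X.underlying = symmDiff C.underlying D.underlying := by
      refine htheta _ (O.isCircuit hX) ?_ ?_ ?_
      · intro h; exact (h.ge hg) h0
      · intro h; exact (h.ge (show D g ≠ 0 by simpa [hgD] using hg)) h0
      · intro a ha
        by_contra hcon
        simp only [Set.mem_union, SignedSet.mem_underlying, not_or, not_not] at hcon ha
        rcases h a ha with h | h
        · exact ha (h.trans hcon.1)
        · exact ha (h.trans hcon.2)
    have hmem : ∀ a, X a ≠ 0 ↔ (C a ≠ 0 ∧ D a = 0) ∨ (D a ≠ 0 ∧ C a = 0) := by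
      intro a
      have : a ∈ X.underlying ↔ a ∈ symmDiff C.underlying D.underlying := by rw [hXu]
      rw [Set.mem_symmDiff] at this
      simpa using this
    refine ⟨X, hX, hXu, fun a ha => ?_, fun a ha => ?_⟩
    · by_cases hXa : X a = 0
      · have := (hmem a).not.1 (not_not.2 hXa)
        by_contra hcon
        exact this (Or.inl ⟨fun h => hcon (hXa.trans h.symm), ha⟩)
      · exact (h a hXa).resolve_right fun h => hXa (h.trans ha)
    · by_cases hXa : X a = 0
      · have := (hmem a).not.1 (not_not.2 hXa)
        by_contra hcon
        exact this (Or.inr ⟨fun h => hcon (hXa.trans h.symm), ha⟩)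
      · exact (h a hXa).resolve_left fun h => hXa (h.trans ha)
  obtain ⟨X, hX, hXu, hXC, hXD⟩ := elim D hD hne htheta f hf hfD
  -- If `C` and `D` agreed at `g`, eliminating between `C` and `-D` would give another signing of
  -- the third circuit, equal to `X` on the part private to `C` and opposite on the part private to
  -- `D`.
  have hopp : ∀ g, C g ≠ 0 → D g ≠ 0 → D g = -C g := by
    intro g hgC hgD
    by_contra hcon
    have hg : (-D) g = -C g := by
      rw [Pi.neg_apply]
      generalize C g = s at *
      generalize D g = t at *
      revert s t; decide
    obtain ⟨Y, hY, hYu, hYC, hYD⟩ := elim (-D) (O.neg_mem hD) (by simpa using hne)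
      (by simpa using htheta) g hgC hg
    obtain ⟨a, haC, haD⟩ : ∃ a, C a ≠ 0 ∧ D a = 0 := by
      by_contra! h
      exact hne.symm ((O.isCircuit hD).eq_of_superset_isCircuit (O.isCircuit hC) h |>.symm)
    obtain ⟨b, hbD, hbC⟩ : ∃ b, D b ≠ 0 ∧ C b = 0 := by
      by_contra! h
      exact hne ((O.isCircuit hC).eq_of_superset_isCircuit (O.isCircuit hD) h |>.symm)
    have ha1 := hXC a haD
    have ha2 := hYC a (by simpa using haD)
    have hb1 := hXD b hbC
    have hb2 := hYD b hbC
    rcases O.eq_or_eq_neg hX hY (by simpa [hXu] using hYu) with rfl | rfl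
    · exact hbD (SignType.self_eq_neg_iff.1 (hb1.symm.trans hb2))
    · exact haC (SignType.neg_eq_self_iff.1 ((congrArg Neg.neg ha1).symm.trans ha2))
  refine ⟨X, hX, hXu, fun a => ?_⟩
  by_cases hD0 : D a = 0
  · rw [hXC a hD0, hD0]; simp
  by_cases hC0 : C a = 0
  · rw [hXD a hC0, hC0]; simp
  have : X a = 0 := by
    by_contra hX0
    have : a ∈ X.underlying := hX0
    rw [hXu, Set.mem_symmDiff] at this
    rcases this with h | h
    · exact h.2 hD0
    · exact h.2 hC0
  rw [this, hopp a hC0 hD0]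
  simp

end Matroid.Orientation

/-! ### Regularity: the lattice of integer relations -/

namespace SignedSet
variable {α : Type u}

open scoped Classical in
/-- The integer vector of a signed set with finite domain. -/
noncomputable def intVec (X : SignedSet α) : α →₀ ℤ :=
  if h : X.underlying.Finite then
    Finsupp.ofSupportFinite (fun a => (X a : ℤ)) (h.subset fun a ha h => ha (by simp [h]))
  else 0

theorem intVec_apply {X : SignedSet α} (h : X.underlying.Finite) (a : α) :
    X.intVec a = (X a : ℤ) := by
  rw [intVec, dif_pos h]; rfl

end SignedSet

namespace Matroid.Orientation

variable {α : Type u} {M : Matroid α} (O : M.Orientation)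

theorem intVec_apply [M.Finitary] {C : SignedSet α} (hC : C ∈ O.circuits) (a : α) :
    C.intVec a = (C a : ℤ) :=
  SignedSet.intVec_apply (O.isCircuit hC).finite a

theorem intVec_neg [M.Finitary] {C : SignedSet α} (hC : C ∈ O.circuits) :
    (-C).intVec = -C.intVec := by
  ext a
  rw [O.intVec_apply (O.neg_mem hC), Finsupp.neg_apply, O.intVec_apply hC]
  simp

theorem intVec_apply_eq_zero [M.Finitary] {C : SignedSet α} (hC : C ∈ O.circuits) {a : α} :
    C.intVec a = 0 ↔ C a = 0 := by
  rw [O.intVec_apply hC]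
  generalize C a = s
  revert s; decide

/-- A circuit that contains at least two elements outside a base is, as an integer vector, the
difference of two signed circuits with fewer elements outside the base. -/
theorem exists_intVec_eq_sub [M.Finitary] (hM : M.IsBinary) {B : Set α} (hB : M.IsBase B)
    {C : SignedSet α} (hC : C ∈ O.circuits) (hCB : (C.underlying \ B).Nontrivial) :
    ∃ X ∈ O.circuits, ∃ D ∈ O.circuits, C.intVec = X.intVec - D.intVec ∧
      X.underlying \ B ⊂ C.underlying \ B ∧ D.underlying \ B ⊂ C.underlying \ B := by
  have hnot : ∀ K, M.IsCircuit K → ∃ a ∈ K, a ∉ B := fun K hK => by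
    by_contra! h
    exact hK.not_indep (hB.indep.subset h)
  have hCc := O.isCircuit hC
  let S : Set (Set α) := {K | M.IsCircuit K ∧ K ≠ C.underlying ∧ K ⊆ C.underlying ∪ B}
  have hS : S.Nonempty := by
    obtain ⟨f, hf, g, hg, hfg⟩ := hCB
    refine ⟨M.fundCircuit f B, hB.fundCircuit_isCircuit (hCc.subset_ground hf.1) hf.2, ?_, ?_⟩
    · intro h
      rcases M.fundCircuit_subset_insert f B (h.ge hg.1) with h | h
      · exact hfg h.symm
      · exact hg.2 h
    · exact (M.fundCircuit_subset_insert f B).trans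
        (Set.insert_subset (Or.inl hf.1) Set.subset_union_right)
  obtain ⟨K, ⟨hK, hKC, hKB⟩, hKmin⟩ :=
    (measure fun K : Set α => (K \ C.underlying).ncard).wf.has_min S hS
  have hmin : ∀ J, M.IsCircuit J → J ≠ C.underlying → J ⊆ C.underlying ∪ K →
      K ⊆ J ∪ C.underlying := by
    intro J hJ hJC hJK
    have h1 : J \ C.underlying ⊆ K \ C.underlying :=
      fun a ha => ⟨(hJK ha.1).resolve_left ha.2, ha.2⟩
    have h2 := Set.eq_of_subset_of_ncard_le h1
      (not_lt.1 (hKmin J ⟨hJ, hJC, hJK.trans (Set.union_subset Set.subset_union_left hKB)⟩))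
      (hK.finite.subset Set.sdiff_subset)
    intro a ha
    by_cases haC : a ∈ C.underlying
    · exact Or.inr haC
    · exact Or.inl (h2.ge ⟨ha, haC⟩).1
  -- Minimality makes `C` and `K` a theta. Signing `K` oppositely to `C` at `h` makes the third
  -- circuit `X` their sum. Then `X` loses `h`, and `D` misses whatever element `X` has outside `B`.
  obtain ⟨h, hhK, hhB⟩ := hnot K hK
  have hhC : h ∈ C.underlying := (hKB hhK).resolve_right hhB
  obtain ⟨D, hD, rfl, hDh⟩ := O.exists_signing_apply_eq hK hhK (s := -C h)
    (by simpa using hhC)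
  obtain ⟨X, hX, hXu, hXa⟩ := O.exists_eq_add_of_theta hC hD hKC
    (fun J hJ hJC hJD hJs => hM.eq_symmDiff_of_minimal hCc hK hKC hmin hJ hJC hJD hJs) hhC hDh
  have hDC : D.underlying \ B ⊆ C.underlying \ B :=
    fun a ha => ⟨(hKB ha.1).resolve_right ha.2, ha.2⟩
  refine ⟨X, hX, D, hD, ?_, ?_, ?_⟩
  · ext a
    rw [Finsupp.sub_apply, O.intVec_apply hC, O.intVec_apply hX, O.intVec_apply hD, hXa]
    ring
  · refine ⟨?_, fun hsub => ?_⟩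
    · rintro a ⟨ha, haB⟩
      rw [hXu] at ha
      rcases ha with ha | ha
      · exact ⟨ha.1, haB⟩
      · exact hDC ⟨ha.1, haB⟩
    · have := (hsub ⟨hhC, hhB⟩).1
      rw [hXu] at this
      rcases this with h' | h'
      · exact h'.2 hhK
      · exact h'.2 hhC
  · refine ⟨hDC, fun hsub => ?_⟩
    obtain ⟨a, ha, haB⟩ := hnot _ (O.isCircuit hX)
    rw [hXu] at ha
    rcases ha with ha | ha
    · exact ha.2 (hsub ⟨ha.1, haB⟩).1
    · exact ha.2 (hDC ⟨ha.1, haB⟩).1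

/-- Regularity: the signed circuits lie in a lattice of integer vectors in which the support of
each nonzero vector contains a circuit. -/
theorem exists_relation_lattice [M.Finitary] (hM : M.IsBinary) :
    ∃ R : Submodule ℤ (α →₀ ℤ), (∀ C ∈ O.circuits, C.intVec ∈ R) ∧
      ∀ x ∈ R, x ≠ 0 → ∃ C ⊆ (x.support : Set α), M.IsCircuit C := by
  classical
  obtain ⟨B, hB⟩ := M.exists_isBase
  have hF : ∀ f, ∃ C : SignedSet α, f ∈ M.E \ B →
      C ∈ O.circuits ∧ C.underlying = M.fundCircuit f B ∧ C f = 1 := by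
    intro f
    by_cases hf : f ∈ M.E \ B
    · obtain ⟨C, h⟩ := O.exists_signing_apply_eq (hB.fundCircuit_isCircuit hf.1 hf.2)
        (M.mem_fundCircuit f B) one_ne_zero
      exact ⟨C, fun _ => h⟩
    · exact ⟨0, fun h => absurd h hf⟩
  choose F hF using hF
  set P : (α →₀ ℤ) →ₗ[ℤ] (α →₀ ℤ) :=
    Finsupp.linearCombination ℤ fun f => if f ∈ M.E \ B then (F f).intVec else 0 with hP
  -- Fixed vectors of `P` are those equal to the combination of fundamental circuits given by their
  -- coordinates outside `B`. Unlike a bare span, this description is visibly closed under division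
  -- by 2.
  refine ⟨LinearMap.eqLocus P LinearMap.id ⊓ Finsupp.supported ℤ ℤ M.E, ?_, ?_⟩
  · have main : ∀ n, ∀ C ∈ O.circuits, (C.underlying \ B).ncard = n →
        P C.intVec = C.intVec := by
      intro n
      induction n using Nat.strong_induction_on with
      | _ n ih =>
      intro C hC hn
      have hCc := O.isCircuit hC
      have hfin : (C.underlying \ B).Finite := hCc.finite.subset Set.sdiff_subset
      by_cases hnt : (C.underlying \ B).Nontrivial
      · obtain ⟨X, hX, D, hD, hCXD, hXB, hDB⟩ := O.exists_intVec_eq_sub hM hB hC hnt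
        rw [hCXD, map_sub, ih _ (hn ▸ Set.ncard_lt_ncard hXB hfin) X hX rfl,
          ih _ (hn ▸ Set.ncard_lt_ncard hDB hfin) D hD rfl]
      · rw [Set.not_nontrivial_iff] at hnt
        obtain ⟨f, hfC, hfB⟩ : ∃ f ∈ C.underlying, f ∉ B := by
          by_contra! h
          exact hCc.not_indep (hB.indep.subset h)
        have hfE : f ∈ M.E \ B := ⟨hCc.subset_ground hfC, hfB⟩
        obtain ⟨hFO, hFu, hFf⟩ := hF f hfE
        have hsub : C.underlying ⊆ insert f B := fun a ha => by
          by_cases haB : a ∈ B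
          · exact Or.inr haB
          · exact Or.inl (hnt ⟨ha, haB⟩ ⟨hfC, hfB⟩)
        have hPF : P (F f).intVec = (F f).intVec := by
          rw [hP, Finsupp.linearCombination_apply, Finsupp.sum, Finset.sum_eq_single f]
          · rw [if_pos hfE, O.intVec_apply hFO, hFf]; simp
          · intro a ha haf
            rw [Finsupp.mem_support_iff, Ne, O.intVec_apply_eq_zero hFO] at ha
            have haB : a ∈ B := by
              have : a ∈ (F f).underlying := ha
              rw [hFu] at this
              exact (M.fundCircuit_subset_insert f B this).resolve_left haf
            rw [if_neg (fun h => h.2 haB), smul_zero]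
          · intro h
            rw [Finsupp.notMem_support_iff] at h
            rw [h, zero_smul]
        rcases O.eq_or_eq_neg hFO hC
          ((hCc.eq_fundCircuit_of_subset hB.indep hsub).trans hFu.symm) with rfl | rfl
        · exact hPF
        · rw [O.intVec_neg hFO, map_neg, hPF]
    intro C hC
    refine ⟨main _ C hC rfl, ?_⟩
    rw [SetLike.mem_coe, Finsupp.mem_supported]
    intro a ha
    rw [Finset.mem_coe, Finsupp.mem_support_iff, Ne, O.intVec_apply_eq_zero hC] at ha
    exact (O.isCircuit hC).subset_ground ha
  · obtain ⟨V, _, _, v, hv, hv'⟩ := hM.exists_vectors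
    have hsmul : ∀ (n : ℤ) (w : V), n • w = if n % 2 = 0 then 0 else w := by
      intro n w
      rw [← Int.cast_smul_eq_zsmul (ZMod 2)]
      split_ifs with h
      · rw [(ZMod.intCast_zmod_eq_zero_iff_dvd n 2).2 (Int.dvd_of_emod_eq_zero h), zero_smul]
      · have : ((n : ℤ) : ZMod 2) = ((1 : ℤ) : ZMod 2) :=
          (ZMod.intCast_eq_intCast_iff_dvd_sub _ _ 2).2 (by push_cast; omega)
        rw [this, Int.cast_one, one_smul]
    set φ : (α →₀ ℤ) →ₗ[ℤ] V := Finsupp.linearCombination ℤ v with hφ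
    have hφC : ∀ C ∈ O.circuits, φ C.intVec = 0 := by
      intro C hC
      have hsupp : (C.intVec.support : Set α) = C.underlying := by
        ext a
        rw [Finset.mem_coe, Finsupp.mem_support_iff, Ne, O.intVec_apply_eq_zero hC]
        rfl
      rw [← hv C.intVec.support (hsupp ▸ O.isCircuit hC), hφ, Finsupp.linearCombination_apply,
        Finsupp.sum]
      refine Finset.sum_congr rfl fun a ha => ?_
      rw [Finsupp.mem_support_iff, Ne, O.intVec_apply_eq_zero hC] at ha
      rw [hsmul, O.intVec_apply hC, if_neg]
      generalize C a = s at *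
      revert s; decide
    have hφP : ∀ x, φ (P x) = 0 := by
      intro x
      rw [hP, Finsupp.linearCombination_apply (l := x), Finsupp.sum, map_sum]
      refine Finset.sum_eq_zero fun a _ => ?_
      rw [map_smul]
      split_ifs with h
      · rw [hφC _ (hF a h).1, smul_zero]
      · rw [map_zero, smul_zero]
    -- Descent on one nonzero coordinate: if some entry is odd, the odd entries form a zero-sum set
    -- in the binary representation; otherwise halve the vector.
    suffices H : ∀ n, ∀ x : α →₀ ℤ, P x = x → (x.support : Set α) ⊆ M.E →
        ∀ a, x a ≠ 0 → (x a).natAbs = n → ∃ C ⊆ (x.support : Set α), M.IsCircuit C by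
      rintro x ⟨hx, hxE⟩ hx0
      obtain ⟨a, ha⟩ := Finsupp.ne_iff.1 hx0
      exact H _ x hx ((Finsupp.mem_supported _ _).1 hxE) a ha rfl
    intro n
    induction n using Nat.strong_induction_on with
    | _ n ih =>
    intro x hx hxE a ha hn
    by_cases hodd : ∃ b, x b % 2 ≠ 0
    · obtain ⟨b, hb⟩ := hodd
      have hsub : ((x.support.filter fun c => x c % 2 ≠ 0 : Finset α) : Set α) ⊆ x.support :=
        Finset.coe_subset.2 (Finset.filter_subset _ _)
      obtain ⟨C, hC, hCc⟩ := hv' (x.support.filter fun c => x c % 2 ≠ 0) (hsub.trans hxE)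
        ⟨b, by
          rw [Finset.mem_filter, Finsupp.mem_support_iff]
          exact ⟨fun h => hb (by rw [h]; rfl), hb⟩⟩ (by
          have := hφP x
          rw [hx, hφ, Finsupp.linearCombination_apply, Finsupp.sum] at this
          rw [← this, Finset.sum_filter]
          refine Finset.sum_congr rfl fun c _ => ?_
          rw [hsmul]
          split_ifs <;> simp_all)
      exact ⟨C, hC.trans hsub, hCc⟩
    · push Not at hodd
      set y : α →₀ ℤ := x.mapRange (· / 2) (by simp) with hy
      have hya : ∀ b, x b = 2 * y b := fun b => by
        have := hodd b
        rw [hy, Finsupp.mapRange_apply]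
        omega
      have hxy : x = (2 : ℤ) • y := by
        ext b; rw [Finsupp.smul_apply, hya b, smul_eq_mul]
      have hPy : P y = y := by
        rw [hxy, map_smul] at hx
        exact smul_right_injective _ (two_ne_zero (α := ℤ)) hx
      have hsupp : y.support = x.support := by
        ext b
        rw [Finsupp.mem_support_iff, Finsupp.mem_support_iff, hya b]
        simp
      have := hya a
      rw [← hsupp]
      exact ih _ (by omega) y hPy (hsupp ▸ hxE) a (by omega) rfl

end Matroid.Orientation

/-! ### Conformal signed circuits -/

namespace Matroid.Orientation

variable {α : Type u} {M : Matroid α} (O : M.Orientation)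

/-- Subtract from `x` the largest multiple of a signed circuit that reverses no sign of `x`. -/
theorem exists_sub_smul_intVec [M.Finitary] {x : α →₀ ℤ} {C : SignedSet α} (hC : C ∈ O.circuits)
    (hCx : ∀ a, C a ≠ 0 → x a ≠ 0) {a₀ : α} (ha₀ : 0 < (C a₀ : ℤ) * x a₀) :
    ∃ m : ℤ, 0 < m ∧ (∀ a, (x - m • C.intVec) a ≠ 0 → 0 < x a * (x - m • C.intVec) a) ∧
      (x - m • C.intVec).support ⊂ x.support := by
  have hS : (x.support.filter fun a => 0 < (C a : ℤ) * x a).Nonempty := by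
    refine ⟨a₀, Finset.mem_filter.2 ⟨Finsupp.mem_support_iff.2 fun h => ?_, ha₀⟩⟩
    simp [h] at ha₀
  -- The multiple is the least `|x a|` where `C` and `x` share a sign. That coordinate vanishes;
  -- where the signs differ, absolute values only grow.
  obtain ⟨a₁, ha₁, hmin⟩ := Finset.exists_min_image _ (fun a => |x a|) hS
  rw [Finset.mem_filter, Finsupp.mem_support_iff] at ha₁
  have hval : ∀ a, (x - |x a₁| • C.intVec) a = x a - |x a₁| * C a := fun a => by
    rw [Finsupp.sub_apply, Finsupp.smul_apply, O.intVec_apply hC, smul_eq_mul]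
  have hpos : 0 < |x a₁| := abs_pos.2 ha₁.1
  have hle : ∀ a, 0 < (C a : ℤ) * x a → |x a₁| ≤ |x a| := fun a ha => by
    refine hmin a (Finset.mem_filter.2 ⟨Finsupp.mem_support_iff.2 fun h => ?_, ha⟩)
    simp [h] at ha
  have hsign : ∀ a, (x - |x a₁| • C.intVec) a ≠ 0 → 0 < x a * (x - |x a₁| • C.intVec) a := by
    intro a ha
    rw [hval] at ha ⊢
    have h1 := hle a
    have h2 := hCx a
    generalize |x a₁| = m at *
    rcases (C a).trichotomy with h | h | h
    · rw [h] at ha h1 h2 ⊢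
      simp only [SignType.coe_neg_one, mul_neg, mul_one, sub_neg_eq_add, neg_mul, one_mul] at *
      rcases lt_or_gt_of_ne (h2 (by decide)) with h' | h'
      · have := h1 (by omega)
        rw [abs_of_neg h'] at this
        exact mul_pos_of_neg_of_neg h' (by omega)
      · exact mul_pos h' (by omega)
    · rw [h] at ha ⊢
      simp only [SignType.coe_zero, mul_zero, sub_zero] at *
      exact mul_self_pos.2 ha
    · rw [h] at ha h1 h2 ⊢
      simp only [SignType.coe_one, mul_one, one_mul] at *
      rcases lt_or_gt_of_ne (h2 (by decide)) with h' | h'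
      · exact mul_pos_of_neg_of_neg h' (by omega)
      · have := h1 h'
        rw [abs_of_pos h'] at this
        exact mul_pos h' (by omega)
  refine ⟨|x a₁|, hpos, hsign, ?_, fun hsub => ?_⟩
  · intro a ha
    rw [Finsupp.mem_support_iff] at ha ⊢
    intro h0
    have := hsign a ha
    simp [h0] at this
  · have h := hsub (Finsupp.mem_support_iff.2 ha₁.1)
    rw [Finsupp.mem_support_iff, hval] at h
    apply h
    have h1 := ha₁.2
    rcases (C a₁).trichotomy with h' | h' | h' <;> rw [h'] at h1 ⊢
    · simp only [SignType.coe_neg_one, neg_mul, one_mul] at h1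
      rw [abs_of_neg (by omega)]; simp
    · simp at h1
    · simp only [SignType.coe_one, one_mul] at h1
      rw [abs_of_pos h1]; simp

/-- A nonzero relation has a conformal signed circuit. -/
theorem exists_conformal [M.Finitary] {R : Submodule ℤ (α →₀ ℤ)}
    (hR : ∀ C ∈ O.circuits, C.intVec ∈ R)
    (hR' : ∀ x ∈ R, x ≠ 0 → ∃ C ⊆ (x.support : Set α), M.IsCircuit C) :
    ∀ x ∈ R, x ≠ 0 → ∃ C ∈ O.circuits, ∀ a, C a ≠ 0 → 0 < (C a : ℤ) * x a := by
  suffices H : ∀ s : Finset α, ∀ x ∈ R, x ≠ 0 → x.support = s →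
      ∃ C ∈ O.circuits, ∀ a, C a ≠ 0 → 0 < (C a : ℤ) * x a from
    fun x hx hx0 => H _ x hx hx0 rfl
  intro s
  induction s using Finset.strongInduction with
  | H s ih =>
  intro x hx hx0 hs
  obtain ⟨K, hKx, hK⟩ := hR' x hx hx0
  obtain ⟨a₀, ha₀⟩ := hK.nonempty
  have hxa₀ : x a₀ ≠ 0 := Finsupp.mem_support_iff.1 (hKx ha₀)
  obtain ⟨C, hC, rfl, hCa₀⟩ := O.exists_signing_apply_eq hK ha₀ (s := SignType.sign (x a₀))
    (sign_ne_zero.2 hxa₀)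
  have h0 : 0 < (C a₀ : ℤ) * x a₀ := by
    rw [hCa₀, sign_mul_self]; exact abs_pos.2 hxa₀
  obtain ⟨m, hm, hsign, hsupp⟩ := O.exists_sub_smul_intVec hC
    (fun a ha => Finsupp.mem_support_iff.1 (hKx ha)) h0
  by_cases hy : x - m • C.intVec = 0
  · refine ⟨C, hC, fun a ha => ?_⟩
    rw [sub_eq_zero.1 hy, Finsupp.smul_apply, O.intVec_apply hC, smul_eq_mul, mul_left_comm]
    refine mul_pos hm (mul_self_pos.2 ?_)
    generalize C a = t at *
    revert t; decide
  · obtain ⟨D, hD, hDy⟩ := ih _ (hs ▸ hsupp) _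
      (R.sub_mem hx (R.smul_mem m (hR C hC))) hy rfl
    refine ⟨D, hD, fun a ha => ?_⟩
    have h1 := hDy a ha
    have h2 := hsign a (fun h => by rw [h] at h1; simp at h1)
    nlinarith [mul_pos h1 h2, mul_self_nonneg ((x - m • C.intVec) a)]

/-- Every element of the support of a relation lies in a conformal signed circuit. -/
theorem exists_conformal_through [M.Finitary] {R : Submodule ℤ (α →₀ ℤ)}
    (hR : ∀ C ∈ O.circuits, C.intVec ∈ R)
    (hR' : ∀ x ∈ R, x ≠ 0 → ∃ C ⊆ (x.support : Set α), M.IsCircuit C) {e : α} :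
    ∀ x ∈ R, x e ≠ 0 → ∃ C ∈ O.circuits, C e ≠ 0 ∧ ∀ a, C a ≠ 0 → 0 < (C a : ℤ) * x a := by
  suffices H : ∀ s : Finset α, ∀ x ∈ R, x e ≠ 0 → x.support = s →
      ∃ C ∈ O.circuits, C e ≠ 0 ∧ ∀ a, C a ≠ 0 → 0 < (C a : ℤ) * x a from
    fun x hx hx0 => H _ x hx hx0 rfl
  intro s
  induction s using Finset.strongInduction with
  | H s ih =>
  intro x hx hxe hs
  obtain ⟨C, hC, hCx⟩ := O.exists_conformal hR hR' x hx (by rintro rfl; exact hxe rfl)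
  by_cases hCe : C e = 0
  -- Subtracting a circuit that misses `e` keeps the coordinate at `e` and shrinks the support.
  · obtain ⟨a₀, ha₀⟩ := (O.isCircuit hC).nonempty
    obtain ⟨m, hm, hsign, hsupp⟩ := O.exists_sub_smul_intVec hC
      (fun a ha h => by have := hCx a ha; simp [h] at this) (hCx a₀ ha₀)
    obtain ⟨D, hD, hDe, hDy⟩ := ih _ (hs ▸ hsupp) _
      (R.sub_mem hx (R.smul_mem m (hR C hC)))
      (by rw [Finsupp.sub_apply, Finsupp.smul_apply, O.intVec_apply hC, hCe]; simpa) rfl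
    refine ⟨D, hD, hDe, fun a ha => ?_⟩
    have h1 := hDy a ha
    have h2 := hsign a (fun h => by rw [h] at h1; simp at h1)
    nlinarith [mul_pos h1 h2, mul_self_nonneg ((x - m • C.intVec) a)]
  · exact ⟨C, hC, hCe, hCx⟩

end Matroid.Orientation

/-! ### Construction of the positive cocircuit -/

namespace Matroid

variable {α : Type u} {M : Matroid α}

/-- A set is a cocircuit if no circuit meets it in a single fixed element `e`, while every other
element forms with `e` the intersection of the set with some circuit. -/
theorem isCocircuit_of_forall_exists_isCircuit {D : Set α} {e : α} (he : e ∈ D) (heE : e ∈ M.E)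
    (hne : ∀ C, M.IsCircuit C → C ∩ D ≠ {e})
    (hpair : ∀ f ∈ D, f ≠ e → ∃ C, M.IsCircuit C ∧ C ∩ D = {e, f}) : M.IsCocircuit D := by
  have hDE : D ⊆ M.E := fun f hf => by
    by_cases hfe : f = e
    · exact hfe ▸ heE
    · obtain ⟨C, hC, hCD⟩ := hpair f hf hfe
      exact hC.subset_ground (hCD.ge (Or.inr rfl)).1
  have hcl : ∀ C, M.IsCircuit C → ∀ a ∈ C, ∀ X : Set α, C \ {a} ⊆ X → a ∈ M.closure X :=
    fun C hC a ha X h => M.closure_subset_closure h (hC.mem_closure_sdiff_singleton_of_mem ha)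
  rw [isCocircuit_iff_minimal_compl_nonspanning, Set.minimal_iff_forall_ssubset]
  refine ⟨fun hsp => ?_, fun D' hD' => not_not.2 ?_⟩
  · have heZ : e ∈ M.closure (M.E \ D) := by rw [hsp.closure_eq]; exact heE
    obtain ⟨C, hCs, hC, heC⟩ := exists_isCircuit_of_mem_closure heZ fun h => h.2 he
    refine hne C hC (Set.Subset.antisymm ?_ (by simpa using ⟨heC, he⟩))
    rintro a ⟨haC, haD⟩
    exact (hCs haC).resolve_right fun h => h.2 haD
  · obtain ⟨hsub, f, hfD, hfD'⟩ := Set.ssubset_iff_exists.1 hD'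
    have hZ : M.E \ D ⊆ M.E \ D' := Set.sdiff_subset_sdiff_right hsub
    -- Once `e` is spanned, the circuits meeting `D` in `{e, g}` span every other `g` in `D`.
    have hecl : e ∈ M.closure (M.E \ D') := by
      by_cases hfe : f = e
      · exact M.mem_closure_of_mem' ⟨heE, hfe ▸ hfD'⟩
      · obtain ⟨C, hC, hCD⟩ := hpair f hfD hfe
        refine hcl C hC e (hCD.ge (Or.inl rfl)).1 _ fun a ha => ?_
        by_cases haD : a ∈ D
        · obtain rfl : a = f := (hCD.le ⟨ha.1, haD⟩).resolve_left ha.2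
          exact ⟨hDE hfD, hfD'⟩
        · exact hZ ⟨hC.subset_ground ha.1, haD⟩
    rw [spanning_iff_ground_subset_closure Set.sdiff_subset]
    intro g hg
    by_cases hgD : g ∈ D
    · by_cases hge : g = e
      · exact hge ▸ hecl
      · obtain ⟨C, hC, hCD⟩ := hpair g hgD hge
        rw [← closure_insert_eq_of_mem_closure hecl]
        refine hcl C hC g (hCD.ge (Or.inr rfl)).1 _ fun a ha => ?_
        by_cases haD : a ∈ D
        · exact Or.inl ((hCD.le ⟨ha.1, haD⟩).resolve_right ha.2)
        · exact Or.inr (hZ ⟨hC.subset_ground ha.1, haD⟩)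
    · exact M.mem_closure_of_mem' (hZ ⟨hg, hgD⟩)

namespace Orientation

variable (O : M.Orientation)

/-- The elements outside a maximal set `Z` that contains the negative part of no signed circuit
positive on `e` form a positive cocircuit. -/
theorem exists_positive_cocircuit [M.Finitary] (hM : M.IsBinary) {e : α} (he : e ∈ M.E)
    (hpos : ¬ ∃ C ∈ O.circuits, C.IsPositive ∧ e ∈ C.underlying) :
    ∃ D ∈ O.cocircuits, D.IsPositive ∧ e ∈ D.underlying := by
  classical
  obtain ⟨R, hR, hR'⟩ := O.exists_relation_lattice hM
  let S : Set (Set α) := {Z | e ∉ Z ∧ ∀ C ∈ O.circuits, C e = 1 → ¬ C.neg ⊆ Z}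
  have hS₀ : ∅ ∈ S := by
    refine ⟨Set.notMem_empty e, fun C hC hCe hn => hpos ⟨C, hC, fun a ha => ?_, ?_⟩⟩
    · rcases (C a).trichotomy with h | h | h
      · exact (hn h).elim
      · exact absurd h ha
      · exact h
    · rw [SignedSet.mem_underlying, hCe]; exact one_ne_zero
  obtain ⟨Z, -, hZ⟩ := zorn_subset_nonempty S (fun c hcS hc hcne => by
    refine ⟨⋃₀ c, ⟨?_, fun C hC hCe hn => ?_⟩, fun s hs => Set.subset_sUnion_of_mem hs⟩
    · rintro ⟨s, hs, hes⟩
      exact (hcS hs).1 hes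
    · have hfin : C.neg.Finite := (O.isCircuit hC).finite.subset fun a (ha : C a = -1) => by
        rw [SignedSet.mem_underlying, ha]; decide
      obtain ⟨s, hs, hns⟩ :=
        hc.directedOn.exists_mem_subset_of_finite_of_subset_sUnion hcne hfin hn
      exact (hcS hs).2 C hC hCe hns) ∅ hS₀
  obtain ⟨⟨heZ, hZC⟩, hmax⟩ := hZ
  have hRZ : ∀ x ∈ R, 0 < x e → ∃ a, a ∉ Z ∧ x a < 0 := by
    intro x hx hxe
    obtain ⟨C, hC, hCe, hCx⟩ := O.exists_conformal_through hR hR' x hx hxe.ne'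
    have hCe1 : C e = 1 := by
      have := hCx e hCe
      rcases (C e).trichotomy with h | h | h
      · rw [h] at this; simp at this; omega
      · exact absurd h hCe
      · exact h
    obtain ⟨a, ha, haZ⟩ := Set.not_subset.1 (hZC C hC hCe1)
    have haC : C a = -1 := ha
    have := hCx a (by rw [haC]; decide)
    rw [haC] at this
    exact ⟨a, haZ, by simpa using this⟩
  -- Maximality of `Z`, applied to `insert f Z`.
  have hex : ∀ f, f ∉ Z → f ≠ e → ∃ C ∈ O.circuits, C e = 1 ∧ C f = -1 ∧
      ∀ a, a ∉ Z → a ≠ f → C a ≠ -1 := by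
    intro f hf hfe
    have hins : insert f Z ∉ S := fun h => hf (hmax h (Set.subset_insert f Z) (Or.inl rfl))
    have : ∃ C ∈ O.circuits, C e = 1 ∧ C.neg ⊆ insert f Z := by
      by_contra! h
      exact hins ⟨by simp [heZ, hfe.symm], h⟩
    obtain ⟨C, hC, hCe, hn⟩ := this
    refine ⟨C, hC, hCe, ?_, fun a ha haf h => (hn h).elim haf ha⟩
    by_contra hCf
    refine hZC C hC hCe fun a ha => (hn ha).resolve_left ?_
    rintro rfl
    exact hCf ha
  have hnn : ∀ s : SignType, s ≠ -1 → 0 ≤ (s : ℤ) := by decide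
  -- If `C` is positive at `f ≠ e`, adding the circuit from `hex f` cancels at `f` and contradicts
  -- `hRZ`. This fact yields both the cocircuit property and orthogonality.
  have hnonneg : ∀ C ∈ O.circuits, (∀ a, a ∉ Z → C a ≠ -1) → ∀ f, f ∉ Z → C f = 0 := by
    intro C hC hCZ f hf
    have hvec := O.intVec_apply hC
    by_contra hCf
    have hCf1 : C f = 1 := by
      rcases (C f).trichotomy with h | h | h
      · exact absurd h (hCZ f hf)
      · exact absurd h hCf
      · exact h
    by_cases hfe : f = e
    · obtain ⟨a, haZ, ha⟩ := hRZ _ (hR C hC) (by rw [← hfe, hvec, hCf1]; simp)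
      rw [hvec] at ha
      exact absurd ha (not_lt.2 (hnn _ (hCZ a haZ)))
    · obtain ⟨X, hX, hXe, hXf, hXZ⟩ := hex f hf hfe
      obtain ⟨a, haZ, ha⟩ := hRZ _ (R.add_mem (hR C hC) (hR X hX)) (by
        rw [Finsupp.add_apply, hvec, O.intVec_apply hX, hXe]
        have := hnn _ (hCZ e heZ)
        rw [SignType.coe_one]
        omega)
      rw [Finsupp.add_apply, hvec, O.intVec_apply hX] at ha
      by_cases haf : a = f
      · rw [haf, hCf1, hXf] at ha; simp at ha
      · have h1 := hnn _ (hCZ a haZ)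
        have h2 := hnn _ (hXZ a haZ haf)
        omega
  have hcoc : M.IsCocircuit Zᶜ := by
    refine isCocircuit_of_forall_exists_isCircuit (e := e) heZ he (fun K hK hKe => ?_)
      fun f hf hfe => ?_
    · obtain ⟨C, hC, rfl, hCe⟩ := O.exists_signing_apply_eq hK (hKe.ge rfl).1 one_ne_zero
      have := hnonneg C hC (fun a ha h => ?_) e heZ
      · rw [hCe] at this; exact one_ne_zero this
      · obtain rfl : a = e := hKe.le ⟨by rw [SignedSet.mem_underlying, h]; decide, ha⟩
        rw [hCe] at h
        exact absurd h (by decide)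
    · obtain ⟨C, hC, hCe, hCf, hCZ⟩ := hex f hf hfe
      refine ⟨C.underlying, O.isCircuit hC, Set.Subset.antisymm ?_ ?_⟩
      · rintro a ⟨haC, haZ⟩
        by_contra hcon
        simp only [Set.mem_insert_iff, Set.mem_singleton_iff, not_or] at hcon
        -- At a third common element `a` the sum `C + X` cancels; it is 2 at `e` and, off `Z`, can
        -- be negative only at `f`, where it is at least -1. A conformal `Y` through `e` must be -1
        -- at `f` by `hnonneg`, so subtracting it leaves a vector positive at `e` and nonnegative
        -- off `Z`, against `hRZ`.
        obtain ⟨X, hX, hXe, hXa, hXZ⟩ := hex a haZ hcon.1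
        have hCa : C a = 1 := by
          rcases (C a).trichotomy with h | h | h
          · exact absurd h (hCZ a haZ hcon.2)
          · exact absurd h haC
          · exact h
        have hval : ∀ b, (C.intVec + X.intVec) b = C b + X b := fun b => by
          rw [Finsupp.add_apply, O.intVec_apply hC, O.intVec_apply hX]
        have hxR := R.add_mem (hR C hC) (hR X hX)
        generalize C.intVec + X.intVec = x at hval hxR
        have hxe : x e = 2 := by rw [hval, hCe, hXe]; rfl
        have hxf : -1 ≤ x f := by
          rw [hval, hCf]
          have := hnn _ (hXZ f hf (Ne.symm hcon.2))
          simp only [SignType.coe_neg_one]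
          omega
        have hxZ : ∀ b, b ∉ Z → b ≠ f → 0 ≤ x b := by
          intro b hb hbf
          rw [hval]
          by_cases hba : b = a
          · rw [hba, hCa, hXa]; simp
          · exact add_nonneg (hnn _ (hCZ b hb hbf)) (hnn _ (hXZ b hb hba))
        obtain ⟨Y, hY, hYe, hYx⟩ := O.exists_conformal_through hR hR' x hxR (e := e) (by omega)
        have hYle : ∀ b, b ∉ Z → b ≠ f → (Y b : ℤ) ≤ x b ∧ Y b ≠ -1 := by
          intro b hb hbf
          have h1 := hxZ b hb hbf
          have h2 := hYx b
          rcases (Y b).trichotomy with h | h | h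
          · have := h2 (by rw [h]; decide)
            rw [h] at this
            simp only [SignType.coe_neg_one] at this
            omega
          · rw [h]; exact ⟨by simpa using h1, by decide⟩
          · have := h2 (by rw [h]; decide)
            rw [h] at this ⊢
            simp only [SignType.coe_one] at *
            exact ⟨by omega, by decide⟩
        have hYf : Y f = -1 := by
          by_contra hYf
          refine hYe (hnonneg Y hY (fun b hb => ?_) e heZ)
          by_cases hbf : b = f
          · rwa [hbf]
          · exact (hYle b hb hbf).2
        have hYe1 : (Y e : ℤ) ≤ 1 := by
          generalize Y e = s
          revert s; decide
        obtain ⟨b, hbZ, hb⟩ := hRZ _ (R.sub_mem hxR (hR Y hY)) (by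
          rw [Finsupp.sub_apply, O.intVec_apply hY]; omega)
        rw [Finsupp.sub_apply, O.intVec_apply hY] at hb
        by_cases hbf : b = f
        · rw [hbf, hYf] at hb
          simp only [SignType.coe_neg_one] at hb
          omega
        · have := (hYle b hbZ hbf).1
          omega
      · rintro a (rfl | rfl)
        · exact ⟨by rw [SignedSet.mem_underlying, hCe]; decide, heZ⟩
        · exact ⟨by rw [SignedSet.mem_underlying, hCf]; decide, hf⟩
  set D : SignedSet α := fun a => if a ∈ Z then 0 else 1 with hD
  have hD1 : ∀ a, a ∉ Z → D a = 1 := fun a ha => if_neg ha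
  have hDu : D.underlying = Zᶜ := by
    ext a
    simp [hD]
  refine ⟨D, ⟨hDu ▸ hcoc, fun C hC hne => ?_⟩, fun a ha => hD1 a (by rwa [hDu] at ha), hDu ▸ heZ⟩
  rw [hDu] at hne ⊢
  obtain ⟨f, hfC, hfZ⟩ := hne
  refine ⟨fun h => hfC (hnonneg C hC (fun a ha hCa => ?_) f hfZ), fun h => hfC ?_⟩
  · have := h a ⟨by rw [SignedSet.mem_underlying, hCa]; decide, ha⟩
    rw [hCa, hD1 a ha] at this
    exact absurd this (by decide)
  · refine SignType.neg_eq_zero_iff.1 (hnonneg (-C) (O.neg_mem hC) (fun a ha hCa => ?_) f hfZ)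
    have hCa1 : C a = 1 := neg_injective hCa
    have := h a ⟨by rw [SignedSet.mem_underlying, hCa1]; decide, ha⟩
    rw [hCa1, hD1 a ha] at this
    exact absurd this (by decide)

end Orientation

end Matroid

theorem mainTheorem2 {α : Type u} (M : Matroid α) [M.Finitary] (hM : M.IsBinary)
    (O : M.Orientation) (e : α) (he : e ∈ M.E) :
    ((∃ C ∈ O.circuits, C.IsPositive ∧ e ∈ C.underlying) ∨
      (∃ D ∈ O.cocircuits, D.IsPositive ∧ e ∈ D.underlying)) ∧
    ¬ ((∃ C ∈ O.circuits, C.IsPositive ∧ e ∈ C.underlying) ∧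
      (∃ D ∈ O.cocircuits, D.IsPositive ∧ e ∈ D.underlying)) := by
  refine ⟨or_iff_not_imp_left.2 (O.exists_positive_cocircuit hM he), ?_⟩
  rintro ⟨⟨C, hC, hCpos, heC⟩, D, hD, hDpos, heD⟩
  exact (hD.2 C hC ⟨e, heC, heD⟩).1 fun a ha => (hCpos a ha.1).trans (hDpos a ha.2).symm
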